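/- Let $\mu\in\mathbb C$ and let $I_\nu(x)=\sum_{k\ge0}\frac{(x/2)^{2k+\nu}}{k!\,\Gamma(\nu+k+1)}$ be the modified Bessel function. All square roots and powers are principal branches. For $t\in\mathbb C\setminus(-\infty,0]$, $\epsilon\in\{0,1,-1\}$ and $N\ge 0$ put $$I^{\epsilon}_N(t)=\det\big[I_{\mu+\epsilon+j-k}(\sqrt t)\big]_{j,k=1,\dots,N},\qquad r_N(t)=(-1)^N\frac{I^{1}_N(t)}{I^{0}_N(t)},\qquad \bar r_N(t)=(-1)^N\frac{I^{-1}_N(t)}{I^{0}_N(t)}$$ (the Toeplitz determinants and the reflection coefficients for the weight $z^\mu e^{\frac12\sqrt t(z+1/z)}$; $I^\epsilon_0=1$, and $\bar r_N$ is in general not the complex conjugate of $r_N$). Consider the Painlevé III′ Hamiltonian $tH=q^2p^2-(q^2+v_1q-t)p+\tfrac12(v_1+v_2)q$ and the Schlesinger transformation $T_1$, which acts by $T_1(v_1,v_2)=(v_1+1,v_2+1)$ and $$T_1(p)=\frac qt\Big[q(p-1)-\tfrac12(v_1-v_2)\Big]+1,\qquad T_1(q)=-\frac tq+\frac{\big(\tfrac12(v_1+v_2)+1\big)t}{q\big[q(p-1)-\tfrac12(v_1-v_2)\big]+t}.$$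 Let $p_N=T_1^Np$, $q_N=T_1^Nq$ be obtained from the seed $(v_1,v_2)=(\mu,-\mu)$, $p_0=0$, $q_0=t\frac{d}{dt}\log\big(t^{-\mu/2}I_\mu(\sqrt t)\big)\big|_{t\mapsto 4t}$. Let $t\in\mathbb C\setminus(-\infty,0]$. (1) For every $N\ge0$: if $I^0_n(4t)\ne0$ for $n\le N$ and $I^1_n(4t)\neq0$ for $n<N$, then $p_N(t)=1-r_N(4t)\,\bar r_N(4t)$. (2) For every $N\ge0$: if $I^0_n(4t)\ne0$ for $n\le N+1$ and $I^1_n(4t)\neq0$ for $n\le N$, then $q_N(t)=-\sqrt t\,\dfrac{r_{N+1}(4t)}{r_N(4t)}$, where the prefactor $\sqrt t$ is not rescaled. (3) Under this change of variables the recurrence schemes are equivalent. Let $(r_N)_{N\ge0}$, $(\bar r_N)_{N\ge0}$ be any complex sequences with $r_0=\bar r_0=1$, $r_N\ne0$ for all $N$, and $1-r_N\bar r_N\neq0$ for $N\ge1$. Put $p_N=1-r_N\bar r_N$, $q_N=-\sqrt t\,r_{N+1}/r_N$, and consider the relations $$\text{(a)}\quad p_{N+1}=\frac{q_N^2}{t}(p_N-1)-\mu\frac{q_N}{t}+1\quad(N\ge0),\qquad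 \text{(b)}\quad q_{N+1}=-\frac t{q_N}+\frac{(N+1)t}{q_N[q_N(p_N-1)-\mu]+t}\quad(N\ge0),$$ $$\text{(c}_N\text{)}\quad \sqrt t\,(\bar r_{N+1}r_N-r_{N+1}\bar r_N)+\mu=0,$$ $$\text{(d)}\quad \sqrt t\,(1-r_N\bar r_N)(r_{N+1}+r_{N-1})+Nr_N=0\quad(N\ge1),$$ $$\text{(}\bar{\text d}\text{)}\quad \sqrt t\,(1-r_N\bar r_N)(\bar r_{N+1}+\bar r_{N-1})+N\bar r_N=0\quad(N\ge1),$$ $$\text{(e)}\quad \sqrt t\,(r_{N+1}\bar r_N+r_N\bar r_{N-1})+N\frac{r_N\bar r_N}{1-r_N\bar r_N}-\mu=0=\sqrt t\,(\bar r_{N+1}r_N+\bar r_Nr_{N-1})+N\frac{r_N\bar r_N}{1-r_N\bar r_N}+\mu\quad(N\ge1).$$ Then (a) holds if and only if (c$_N$) holds for all $N\ge0$. Moreover the Hamiltonian scheme (a), (b) is equivalent to [(c$_N$) for all $N\ge0$, and (d)], and also to the discrete Painlevé II recurrences (d), ($\bar{\text d}$) together with the initial relation (c$_0$). If in addition $\bar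 r_N\neq0$ for all $N$, it is equivalent to the coupled recurrences (e) together with (c$_0$). -/

import Mathlib

namespace PainleveIII

noncomputable section

/-! ### Toeplitz determinants and reflection coefficients -/

/-- The principal branch of the square root. -/
def csqrt (t : ℂ) : ℂ := t ^ (1 / 2 : ℂ)

/-- The modified Bessel function `I_ν(x) = (x/2)^ν ∑ₖ (x/2)^(2k) / (k! Γ(ν+k+1))`. At a pole of `Γ`
Mathlib's `Complex.Gamma` is `0`, hence the corresponding term is `0`, as it should be. -/
def besselI (ν x : ℂ) : ℂ :=
  (x / 2) ^ ν * ∑' k : ℕ, (x / 2) ^ (2 * k) / ((k.factorial : ℂ) * Complex.Gamma (ν + k + 1))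

/-- The `N × N` Toeplitz determinant `det [I_{μ+ε+j-k}(√t)]` attached to the weight
`z^μ exp(½√t (z + 1/z))`. -/
def toeplitzDet (μ : ℂ) (ε : ℤ) (N : ℕ) (t : ℂ) : ℂ :=
  Matrix.det (Matrix.of fun j k : Fin N =>
    besselI (μ + (ε : ℂ) + ((j : ℕ) : ℂ) - ((k : ℕ) : ℂ)) (csqrt t))

/-- The reflection coefficient `r_N(t)`. -/
def reflCoeff (μ : ℂ) (N : ℕ) (t : ℂ) : ℂ :=
  (-1) ^ N * (toeplitzDet μ 1 N t / toeplitzDet μ 0 N t)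

/-- The second reflection coefficient `r̄_N(t)`; it is not the complex conjugate of `r_N(t)` in
general, but a variable of its own. -/
def reflCoeffBar (μ : ℂ) (N : ℕ) (t : ℂ) : ℂ :=
  (-1) ^ N * (toeplitzDet μ (-1) N t / toeplitzDet μ 0 N t)

/-! ### The Hamiltonian system and its Schlesinger transformation -/

/-- `t H`, where `H` is the Painlevé III′ Hamiltonian with parameters `(v₁, v₂)`. -/
def tHam (t v₁ v₂ p q : ℂ) : ℂ :=
  q ^ 2 * p ^ 2 - (q ^ 2 + v₁ * q - t) * p + (1 / 2) * (v₁ + v₂) * q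

/-- Hamilton's equations `q' = ∂H/∂p`, `p' = -∂H/∂q` at the point `t`. -/
def SolvesHamiltonAt (v₁ v₂ : ℂ) (p q : ℂ → ℂ) (t : ℂ) : Prop :=
  HasDerivAt q (deriv (fun P => tHam t v₁ v₂ P (q t) / t) (p t)) t ∧
  HasDerivAt p (-deriv (fun Q => tHam t v₁ v₂ (p t) Q / t) (q t)) t

/-- Parameters and Hamiltonian variables, at a fixed value of the independent variable. -/
structure State where
  v₁ : ℂ
  v₂ : ℂ
  p : ℂ
  q : ℂ

/-- The Schlesinger transformation `T₁`, with `(v₁, v₂) ↦ (v₁ + 1, v₂ + 1)` on the parameters. -/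
def schlesingerT₁ (t : ℂ) (X : State) : State where
  v₁ := X.v₁ + 1
  v₂ := X.v₂ + 1
  p := X.q / t * (X.q * (X.p - 1) - (1 / 2) * (X.v₁ - X.v₂)) + 1
  q := -(t / X.q) + ((1 / 2) * (X.v₁ + X.v₂) + 1) * t /
    (X.q * (X.q * (X.p - 1) - (1 / 2) * (X.v₁ - X.v₂)) + t)

/-- The seed: `(v₁, v₂) = (μ, -μ)`, `p₀ = 0` and
`q₀ = t (d/dt) log (t^{-μ/2} I_μ(√t))`, evaluated at `t ↦ 4t`. -/
def seed (μ t : ℂ) : State where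
  v₁ := μ
  v₂ := -μ
  p := 0
  q := (4 * t) * logDeriv (fun u : ℂ => u ^ (-μ / 2) * besselI μ (csqrt u)) (4 * t)

/-- The Hamiltonian variable `p_N = T₁^N p` at the seed. -/
def hamP (μ : ℂ) (N : ℕ) (t : ℂ) : ℂ := ((schlesingerT₁ t)^[N] (seed μ t)).p

/-- The Hamiltonian variable `q_N = T₁^N q` at the seed. -/
def hamQ (μ : ℂ) (N : ℕ) (t : ℂ) : ℂ := ((schlesingerT₁ t)^[N] (seed μ t)).q

/-! ### The recurrences -/

/-- The first recurrence of the Hamiltonian scheme, giving `p_{N+1}`. -/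
def HamRecP (μ t : ℂ) (p q : ℕ → ℂ) : Prop :=
  ∀ N : ℕ, p (N + 1) = q N ^ 2 / t * (p N - 1) - μ * (q N / t) + 1

/-- The second recurrence of the Hamiltonian scheme, giving `q_{N+1}`. -/
def HamRecQ (μ t : ℂ) (p q : ℕ → ℂ) : Prop :=
  ∀ N : ℕ, q (N + 1) = -(t / q N) +
    ((N : ℂ) + 1) * t / (q N * (q N * (p N - 1) - μ) + t)

/-- `½√t (1 - r_N r̄_N)(r_{N+1} + r_{N-1}) + N r_N = 0` for `N ≥ 1`. -/
def DPIIFirst (t : ℂ) (r rb : ℕ → ℂ) : Prop :=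
  ∀ N : ℕ, 1 ≤ N →
    (1 / 2) * csqrt t * (1 - r N * rb N) * (r (N + 1) + r (N - 1)) + (N : ℂ) * r N = 0

/-- `½√t (1 - r_N r̄_N)(r̄_{N+1} + r̄_{N-1}) + N r̄_N = 0` for `N ≥ 1`. -/
def DPIISecond (t : ℂ) (r rb : ℕ → ℂ) : Prop :=
  ∀ N : ℕ, 1 ≤ N →
    (1 / 2) * csqrt t * (1 - r N * rb N) * (rb (N + 1) + rb (N - 1)) + (N : ℂ) * rb N = 0

/-- `½√t (r̄_{N+1} r_N - r_{N+1} r̄_N) + μ = 0` at the index `N`. -/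
def SkewRelationAt (μ t : ℂ) (r rb : ℕ → ℂ) (N : ℕ) : Prop :=
  (1 / 2) * csqrt t * (rb (N + 1) * r N - r (N + 1) * rb N) + μ = 0

/-- The coupled first order recurrences
`½√t (r_{N+1} r̄_N + r_N r̄_{N-1}) + N r_N r̄_N / (1 - r_N r̄_N) - μ = 0`,
`½√t (r̄_{N+1} r_N + r̄_N r_{N-1}) + N r_N r̄_N / (1 - r_N r̄_N) + μ = 0` for `N ≥ 1`. -/
def OPUCRec (μ t : ℂ) (r rb : ℕ → ℂ) : Prop :=
  ∀ N : ℕ, 1 ≤ N →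
    (1 / 2) * csqrt t * (r (N + 1) * rb N + r N * rb (N - 1)) +
      (N : ℂ) * (r N * rb N / (1 - r N * rb N)) - μ = 0 ∧
    (1 / 2) * csqrt t * (rb (N + 1) * r N + rb N * r (N - 1)) +
      (N : ℂ) * (r N * rb N / (1 - r N * rb N)) + μ = 0

/-! ### Basic facts on `T₁` -/

/-- `T₁ (tH) = tH - q (p - 1)`. -/
theorem tHam_schlesingerT₁ (t : ℂ) (X : State) (ht : t ≠ 0) (hq : X.q ≠ 0)
    (hp : (schlesingerT₁ t X).p ≠ 0) :
    tHam t (schlesingerT₁ t X).v₁ (schlesingerT₁ t X).v₂ (schlesingerT₁ t X).p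
      (schlesingerT₁ t X).q = tHam t X.v₁ X.v₂ X.p X.q - X.q * (X.p - 1) := by
  obtain ⟨a, b, p, q⟩ := X
  have hd : q * (q * (p - 1) - (1 / 2) * (a - b)) + t ≠ 0 := by
    intro h
    apply hp
    simp only [schlesingerT₁]
    field_simp
    linear_combination 2 * h
  simp only [schlesingerT₁, tHam] at *
  generalize hD : q * (q * (p - 1) - (1 / 2) * (a - b)) + t = D at *
  have h1 : q / t * (q * (p - 1) - (1 / 2) * (a - b)) + 1 = D / t := by
    rw [← hD]
    field_simp
  rw [h1]
  have h2 : p = (D - t) / q ^ 2 + (1 / 2) * (a - b) / q + 1 := by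
    rw [← hD]
    field_simp
    ring
  rw [h2]
  field_simp
  ring

/-- The iterates of the seed satisfy the recurrences of the Hamiltonian scheme. -/
theorem hamRec_ham (μ t : ℂ) :
    HamRecP μ t (fun N => hamP μ N t) (fun N => hamQ μ N t) ∧
    HamRecQ μ t (fun N => hamP μ N t) (fun N => hamQ μ N t) := by
  have hv : ∀ N : ℕ, ((schlesingerT₁ t)^[N] (seed μ t)).v₁ = μ + N ∧
      ((schlesingerT₁ t)^[N] (seed μ t)).v₂ = -μ + N := by
    intro N
    induction N with
    | zero => simp [seed]
    | succ n ih =>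
      rw [Function.iterate_succ_apply']
      simp only [schlesingerT₁, ih.1, ih.2]
      push_cast
      constructor <;> ring
  constructor
  · intro N
    simp only [hamP, hamQ]
    rw [Function.iterate_succ_apply']
    generalize hX : (schlesingerT₁ t)^[N] (seed μ t) = X
    have h := hv N
    rw [hX] at h
    simp only [schlesingerT₁, h.1, h.2]
    ring
  · intro N
    simp only [hamP, hamQ]
    rw [Function.iterate_succ_apply']
    generalize hX : (schlesingerT₁ t)^[N] (seed μ t) = X
    have h := hv N
    rw [hX] at h
    simp only [schlesingerT₁, h.1, h.2]
    have e1 : (1 / 2 : ℂ) * (μ + N - (-μ + N)) = μ := by ring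
    have e2 : (1 / 2 : ℂ) * (μ + N + (-μ + N)) + 1 = N + 1 := by ring
    rw [e1, e2]

/-- `T₁` is a Bäcklund transformation: it sends solutions of Hamilton's equations with parameters
`(v₁, v₂)` to solutions with parameters `(v₁ + 1, v₂ + 1)`. -/
theorem solvesHamiltonAt_schlesingerT₁ (v₁ v₂ t : ℂ) (p q : ℂ → ℂ) (ht : t ≠ 0) (hq : q t ≠ 0)
    (hp : (schlesingerT₁ t ⟨v₁, v₂, p t, q t⟩).p ≠ 0) (h : SolvesHamiltonAt v₁ v₂ p q t) :
    SolvesHamiltonAt (v₁ + 1) (v₂ + 1) (fun s => (schlesingerT₁ s ⟨v₁, v₂, p s, q s⟩).p)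
      (fun s => (schlesingerT₁ s ⟨v₁, v₂, p s, q s⟩).q) t := by
  have dP : ∀ s a b P Q : ℂ, deriv (fun P => tHam s a b P Q / s) P =
      (2 * Q ^ 2 * P - (Q ^ 2 + a * Q - s)) / s := by
    intro s a b P Q
    have := ((((((hasDerivAt_id P).pow 2).const_mul (Q ^ 2)).sub
      ((hasDerivAt_id P).const_mul (Q ^ 2 + a * Q - s))).add_const
        ((1 / 2) * (a + b) * Q)).div_const s).deriv
    simp only [tHam]
    refine Eq.trans (congrArg (fun f => deriv f P) ?_) (this.trans ?_)
    · funext x; simp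
    · simp; ring
  have dQ : ∀ s a b P Q : ℂ, deriv (fun Q => tHam s a b P Q / s) Q =
      (2 * Q * P ^ 2 - (2 * Q + a) * P + (1 / 2) * (a + b)) / s := by
    intro s a b P Q
    have := (((((((hasDerivAt_id Q).pow 2).mul_const (P ^ 2))).sub
      ((((((hasDerivAt_id Q).pow 2).add ((hasDerivAt_id Q).const_mul a)).sub_const s)).mul_const
        P)).add ((hasDerivAt_id Q).const_mul ((1 / 2) * (a + b)))).div_const s).deriv
    simp only [tHam]
    refine Eq.trans (congrArg (fun f => deriv f Q) ?_) (this.trans ?_)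
    · funext x; simp
    · simp
  obtain ⟨h1, h2⟩ := h
  rw [dP] at h1
  rw [dQ] at h2
  have hd : q t * (q t * (p t - 1) - (1 / 2) * (v₁ - v₂)) + t ≠ 0 := by
    intro h
    apply hp
    simp only [schlesingerT₁]
    field_simp
    linear_combination 2 * h
  have hi := hasDerivAt_id t
  have hinner := (h1.mul (h2.sub_const 1)).sub_const ((1 / 2) * (v₁ - v₂))
  have hden := (h1.mul hinner).add hi
  refine ⟨?_, ?_⟩
  · rw [dP]
    have key := ((hi.div h1 hq).neg).add
      ((hi.const_mul ((1 / 2) * (v₁ + v₂) + 1)).div hden hd)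
    refine HasDerivAt.congr_deriv (f := fun s => (schlesingerT₁ s ⟨v₁, v₂, p s, q s⟩).q) key ?_
    simp only [schlesingerT₁, Pi.mul_apply, Pi.add_apply, id_eq]
    generalize p t = P at *
    generalize q t = Q at *
    generalize hD : Q * (Q * (P - 1) - (1 / 2) * (v₁ - v₂)) + t = D at *
    have e1 : P = (D - t) / Q ^ 2 + (1 / 2) * (v₁ - v₂) / Q + 1 := by
      rw [← hD]
      field_simp
      ring
    rw [e1]
    field_simp
    ring
  · rw [dQ]
    have key := ((h1.div hi ht).mul hinner).add_const 1
    refine HasDerivAt.congr_deriv (f := fun s => (schlesingerT₁ s ⟨v₁, v₂, p s, q s⟩).p) key ?_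
    simp only [schlesingerT₁, Pi.mul_apply, Pi.div_apply, id_eq]
    generalize p t = P at *
    generalize q t = Q at *
    generalize hD : Q * (Q * (P - 1) - (1 / 2) * (v₁ - v₂)) + t = D at *
    have e1 : P = (D - t) / Q ^ 2 + (1 / 2) * (v₁ - v₂) / Q + 1 := by
      rw [← hD]
      field_simp
      ring
    rw [e1]
    field_simp
    ring

end

end PainleveIII

open PainleveIII

/-!
Write `A_n`, `B_n`, `C_n` for the Toeplitz determinants with `ε = 0, 1, -1` at the point `4t`, let
`s = √t`, so that `√(4t) = 2s`, and let `w_m = I_{μ+m}(2s)`.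

The expressions of `p_N` and `q_N` rest on three bilinear identities:
* `s (B_n C_{n+1} - C_n B_{n+1}) = μ A_n A_{n+1}` (`toeplitz_skew`),
* `s (B_n A_{n+2} + B_{n+2} A_n) = (n + 1) A_{n+1} B_{n+1}` (`toeplitz_dPII`),
* `A_{n+1}² - B_{n+1} C_{n+1} = A_n A_{n+2}` (`toeplitz_jacobi`).

Only the Bessel recurrence `s (w_{m-1} - w_{m+1}) = (μ + m) w_m` enters the first two. It says that
the functional `L : z^m ↦ w_m` satisfies `L(z f') = L((s (z⁻¹ - z) - μ) f)` on Laurent polynomials.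
Let `P_n = A_n π_n`, where `π_n` is the monic orthogonal polynomial of degree `n`; its coefficients
are signed minors, which requires no nonvanishing assumption. Expanding a determinant along a
column gives `L(P_n z^{-k}) = 0` for `0 ≤ k < n`, `L(P_n z^{-n}) = A_{n+1}` and
`L(P_n z) = (-1)^n B_{n+1}`, while the constant and leading coefficients of `P_n` are `(-1)^n B_n`
and `A_n`. With `P̄_n` the analogue of `P_n` for the reversed weight `w_{-m}`, the first two
identities are this integration by parts for `f = P_n(z) P̄_n(1/z)` and for
`f = P_{n+1}(z) P_n(z) z^{-n}`, and the third is the value of `L(P_{n+1}(z) z⁻¹ P̄_n(1/z))`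
computed in two ways.

Divided by the `A_n`, the identities state that the reflection coefficients satisfy the skew relation
and discrete Painlevé II, with `1 - r_n r̄_n ≠ 0`. By `recP_of_skew` and `recQ_iff_dPII` these are
the two recurrences of the Hamiltonian scheme, and `seed_q` identifies the initial values through
`(x^{-μ} I_μ(x))' = x^{-μ} I_{μ+1}(x)`; the formulas follow by induction.

The equivalence of the recurrence schemes is algebra at each index. The substitution turns the
recurrence for `p` into the skew relation, hence the denominator in the recurrence for `q` into
`t p_{N+1}`, and that recurrence into discrete Painlevé II. The difference of two consecutive skew
relations exchanges the two discrete Painlevé II equations, and the skew relation at `N` eliminates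
`μ` from the coupled relations at `N + 1`.
-/

namespace PainleveIII

/-! ### Identities between Toeplitz determinants -/

section Toeplitz

variable {R : Type*} [CommRing R]

/-- The `n × n` Toeplitz determinant with symbol coefficients `w`. -/
def toeplitz (w : ℤ → R) (n : ℕ) : R :=
  Matrix.det (Matrix.of fun j k : Fin n => w ((j : ℤ) - (k : ℤ)))

/-- The signed maximal minors of the `(n + 1) × n` Toeplitz matrix `(w_{i-k})`. They are the
coefficients of `A_n π_n`, where `A_n = toeplitz w n` and `π_n` is the monic orthogonal polynomial
of degree `n` on the unit circle; this normalisation makes sense when `A_n` vanishes. -/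
def toeplitzMinor (w : ℤ → R) (n : ℕ) (i : Fin (n + 1)) : R :=
  (-1) ^ (n + (i : ℕ)) *
    Matrix.det (Matrix.of fun a b : Fin n => w ((i.succAbove a : ℕ) - (b : ℤ)))

/-- The pairing of the polynomial with coefficients `toeplitzMinor w n` with `z^{-k}` under the
functional `z^m ↦ w_m`. -/
def minorPairing (w : ℤ → R) (n : ℕ) (k : ℤ) : R :=
  ∑ i : Fin (n + 1), toeplitzMinor w n i * w ((i : ℤ) - k)

theorem toeplitz_neg (w : ℤ → R) (n : ℕ) : toeplitz (fun m => w (-m)) n = toeplitz w n := by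
  unfold toeplitz
  rw [← Matrix.det_transpose]
  congr 1
  ext j k
  simp

theorem toeplitz_neg_add_one (w : ℤ → R) (n : ℕ) :
    toeplitz (fun m => w (-(m + 1))) n = toeplitz (fun m => w (m - 1)) n := by
  rw [← toeplitz_neg (fun m => w (m - 1))]
  simp only [neg_add']

theorem neg_one_pow_mul_self (R : Type*) [CommRing R] (n : ℕ) :
    (-1 : R) ^ n * (-1) ^ n = 1 := by
  rw [← mul_pow]
  simp

theorem toeplitzMinor_zero (w : ℤ → R) (n : ℕ) :
    toeplitzMinor w n 0 = (-1) ^ n * toeplitz (fun m => w (m + 1)) n := by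
  simp [toeplitzMinor, toeplitz, add_sub_right_comm]

theorem toeplitzMinor_last (w : ℤ → R) (n : ℕ) :
    toeplitzMinor w n (Fin.last n) = toeplitz w n := by
  simp [toeplitzMinor, toeplitz, ← two_mul]

theorem sum_toeplitzMinor_mul (w : ℤ → R) (n : ℕ) (v : Fin (n + 1) → R) :
    ∑ i, toeplitzMinor w n i * v i =
      Matrix.det (Matrix.of fun i j : Fin (n + 1) =>
        if (j : ℕ) = n then v i else w ((i : ℤ) - (j : ℤ))) := by
  rw [Matrix.det_succ_column _ (Fin.last n)]
  refine Finset.sum_congr rfl fun i _ => ?_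
  have : (Matrix.of fun i j : Fin (n + 1) =>
      if (j : ℕ) = n then v i else w ((i : ℤ) - (j : ℤ))).submatrix i.succAbove
        (Fin.last n).succAbove =
      Matrix.of fun a b : Fin n => w ((i.succAbove a : ℕ) - (b : ℤ)) := by
    ext a b
    simp [b.isLt.ne]
  rw [this]
  simp only [toeplitzMinor, Matrix.of_apply, Fin.val_last, if_true]
  rw [add_comm n]
  ring

theorem minorPairing_eq_zero (w : ℤ → R) (n : ℕ) (k : ℤ) (h0 : 0 ≤ k) (h1 : k < n) :
    minorPairing w n k = 0 := by
  lift k to ℕ using h0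
  have hk : k < n := by exact_mod_cast h1
  rw [minorPairing, sum_toeplitzMinor_mul]
  refine Matrix.det_zero_of_column_eq (i := (⟨k, by omega⟩ : Fin (n + 1))) (j := Fin.last n)
    (by simp [Fin.ext_iff, hk.ne]) fun i => ?_
  simp [hk.ne]

theorem minorPairing_self (w : ℤ → R) (n : ℕ) :
    minorPairing w n n = toeplitz w (n + 1) := by
  rw [minorPairing, sum_toeplitzMinor_mul, toeplitz]
  congr 1
  ext i j
  simp only [Matrix.of_apply]
  split_ifs with h
  · rw [h]
  · rfl

theorem minorPairing_neg_one (w : ℤ → R) (n : ℕ) :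
    minorPairing w n (-1) = (-1) ^ n * toeplitz (fun m => w (m + 1)) (n + 1) := by
  rw [toeplitz, Matrix.det_succ_column_zero, Finset.mul_sum]
  refine Finset.sum_congr rfl fun i _ => ?_
  simp only [toeplitzMinor, Matrix.of_apply, Matrix.submatrix, Fin.val_zero, pow_add,
    Fin.val_succ]
  have : (Matrix.of fun a b : Fin n => w (((i.succAbove a : ℕ) : ℤ) - ((b : ℕ) + 1 : ℕ) + 1)) =
      Matrix.of fun a b : Fin n => w ((i.succAbove a : ℕ) - (b : ℤ)) := by
    ext a b
    simp only [Matrix.of_apply]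
    congr 1
    push_cast
    ring
  rw [this]
  simp only [Nat.cast_zero, sub_zero, sub_neg_eq_add]
  ring

/-- Summing a double sum over the second index first: the pairing of the reversed weight. -/
theorem sum_minor_neg (w : ℤ → R) (n : ℕ) (a : R) (k : ℤ) :
    ∑ j : Fin (n + 1), a * toeplitzMinor (fun m => w (-m)) n j * w (k - j) =
      a * minorPairing (fun m => w (-m)) n k := by
  rw [minorPairing, Finset.mul_sum]
  refine Finset.sum_congr rfl fun j _ => ?_
  rw [neg_sub, mul_assoc]

/-- The Desnanot–Jacobi identity for Toeplitz determinants. -/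
theorem toeplitz_jacobi (w : ℤ → R) (n : ℕ) :
    toeplitz w (n + 1) ^ 2 -
        toeplitz (fun m => w (m + 1)) (n + 1) * toeplitz (fun m => w (m - 1)) (n + 1) =
      toeplitz w n * toeplitz w (n + 2) := by
  have hC := toeplitz_neg_add_one w (n + 1)
  set c := toeplitzMinor w (n + 1)
  set e := toeplitzMinor (fun m => w (-m)) n
  -- Summing over `j` first leaves the constant and the leading term of `P_{n+1}`, summing over `i`
  -- first leaves the leading term of `P̄_n`.
  have h1 : ∑ i, ∑ j, c i * e j * w ((i : ℤ) - 1 - j) =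
      toeplitz w (n + 1) ^ 2 -
        toeplitz (fun m => w (m + 1)) (n + 1) * toeplitz (fun m => w (m - 1)) (n + 1) := by
    simp only [e, sum_minor_neg]
    rw [Fin.sum_univ_succ, Fin.sum_univ_castSucc]
    have : ∀ i : Fin n, c i.castSucc.succ *
        minorPairing (fun m => w (-m)) n (((i.castSucc.succ : Fin (n + 2)) : ℕ) - 1 : ℤ) = 0 := by
      intro i
      rw [minorPairing_eq_zero _ _ _ (by simp) (by simp), mul_zero]
    rw [Finset.sum_eq_zero fun i _ => this i]
    have h0 : ((((0 : Fin (n + 2)) : ℕ) : ℤ) - 1) = -1 := by simp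
    have hl : (((((Fin.last n).succ : Fin (n + 2)) : ℕ) : ℤ) - 1) = n := by simp
    rw [h0, hl, minorPairing_neg_one, minorPairing_self, toeplitz_neg, hC, Fin.succ_last]
    simp only [c, toeplitzMinor_zero, toeplitzMinor_last]
    have := neg_one_pow_mul_self R n
    linear_combination (-toeplitz (fun m => w (m + 1)) (n + 1) *
      toeplitz (fun m => w (m - 1)) (n + 1)) * this
  have h2 : ∑ i, ∑ j, c i * e j * w ((i : ℤ) - 1 - j) = toeplitz w n * toeplitz w (n + 2) := by
    rw [Finset.sum_comm]
    have : ∀ j, ∑ i, c i * e j * w ((i : ℤ) - 1 - j) = e j * minorPairing w (n + 1) (j + 1) := by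
      intro j
      rw [minorPairing, Finset.mul_sum]
      refine Finset.sum_congr rfl fun i _ => ?_
      rw [sub_sub, add_comm (1 : ℤ)]
      ring
    rw [Finset.sum_congr rfl fun j _ => this j, Fin.sum_univ_castSucc]
    rw [Finset.sum_eq_zero fun j _ => ?_]
    · have := minorPairing_self w (n + 1)
      push_cast at this
      simp only [Fin.val_last, this, e, toeplitzMinor_last, toeplitz_neg, zero_add]
    · rw [minorPairing_eq_zero _ _ _ (by positivity) (by simp), mul_zero]
  rw [← h1, h2]

/-- One half of the double sum in `toeplitz_skew`: the shift by `-1` leaves only the constant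
term of the polynomial attached to `w`. -/
theorem sum_sum_minor_sub_one (w : ℤ → R) (n : ℕ) :
    ∑ i : Fin (n + 1), ∑ j : Fin (n + 1), toeplitzMinor w n i *
        toeplitzMinor (fun m => w (-m)) n j * w ((i : ℤ) - 1 - j) =
      toeplitz (fun m => w (m + 1)) n * toeplitz (fun m => w (m - 1)) (n + 1) := by
  have hC := toeplitz_neg_add_one w (n + 1)
  simp only [sum_minor_neg]
  rw [Fin.sum_univ_succ, Finset.sum_eq_zero fun i _ => ?_]
  · have h0 : ((((0 : Fin (n + 1)) : ℕ) : ℤ) - 1) = -1 := by simp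
    rw [h0, minorPairing_neg_one, hC, toeplitzMinor_zero]
    have := neg_one_pow_mul_self R n
    linear_combination (toeplitz (fun m => w (m + 1)) n *
      toeplitz (fun m => w (m - 1)) (n + 1)) * this
  · rw [minorPairing_eq_zero _ _ _ (by simp) (by simp), mul_zero]

/-- The other half of the double sum in `toeplitz_skew`; the weight `f i` survives only at the
leading coefficient. -/
theorem sum_sum_minor_weight (w : ℤ → R) (n : ℕ) (f : ℕ → R) :
    ∑ i : Fin (n + 1), ∑ j : Fin (n + 1), f i * toeplitzMinor w n i *
        toeplitzMinor (fun m => w (-m)) n j * w ((i : ℤ) - j) =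
      f n * (toeplitz w n * toeplitz w (n + 1)) := by
  simp only [sum_minor_neg]
  rw [Fin.sum_univ_castSucc, Finset.sum_eq_zero fun i _ => ?_]
  · rw [Fin.val_last, minorPairing_self, toeplitz_neg, toeplitzMinor_last]
    ring
  · rw [minorPairing_eq_zero _ _ _ (by simp) (by simp), mul_zero]

/-- The sum over all `(i, j)` with the roles of `w` and its reversal exchanged. -/
theorem sum_sum_minor_swap (w : ℤ → R) (n : ℕ) (f : ℕ → R) (k : ℤ) :
    ∑ i : Fin (n + 1), ∑ j : Fin (n + 1), f j * toeplitzMinor w n i *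
        toeplitzMinor (fun m => w (-m)) n j * w ((i : ℤ) - j + k) =
      ∑ i : Fin (n + 1), ∑ j : Fin (n + 1), f i * toeplitzMinor (fun m => w (-m)) n i *
        toeplitzMinor w n j * w (-((i : ℤ) - j - k)) := by
  rw [Finset.sum_comm]
  refine Finset.sum_congr rfl fun i _ => Finset.sum_congr rfl fun j _ => ?_
  rw [show -((i : ℤ) - j - k) = j - i + k by ring]
  ring

/-- For coefficients satisfying the Bessel recurrence, integrating the derivative of
`π_n(z) π̄_n(1/z)` by parts gives the skew relation. -/
theorem toeplitz_skew (w : ℤ → R) (s μ : R)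
    (hw : ∀ m : ℤ, s * (w (m - 1) - w (m + 1)) = (μ + m) * w m) (n : ℕ) :
    s * (toeplitz (fun m => w (m + 1)) n * toeplitz (fun m => w (m - 1)) (n + 1) -
        toeplitz (fun m => w (m - 1)) n * toeplitz (fun m => w (m + 1)) (n + 1)) =
      μ * (toeplitz w n * toeplitz w (n + 1)) := by
  have hA := sum_sum_minor_sub_one w n
  have hB := sum_sum_minor_sub_one (fun m => w (-m)) n
  have hμ := sum_sum_minor_weight w n (fun _ => μ)
  have hi := sum_sum_minor_weight w n (fun i => (i : R))
  have hj := sum_sum_minor_weight (fun m => w (-m)) n (fun i => (i : R))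
  have sB := sum_sum_minor_swap w n (fun _ => 1) 1
  have sj := sum_sum_minor_swap w n (fun i => (i : R)) 0
  have e1 := toeplitz_neg_add_one w n
  have e2 : toeplitz (fun m => w (-(m - 1))) (n + 1) =
      toeplitz (fun m => w (m + 1)) (n + 1) := by
    rw [← toeplitz_neg (fun m => w (m + 1))]
    congr 1
    funext m
    congr 1
    ring
  simp only [neg_neg, toeplitz_neg, e1, e2] at hB hj
  simp only [sub_zero, add_zero] at sj
  rw [hj] at sj
  simp only [one_mul, sub_right_comm _ _ (1 : ℤ)] at sB
  rw [hB] at sB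
  rw [← hA, ← sB]
  calc _ = ∑ i : Fin (n + 1), ∑ j : Fin (n + 1), toeplitzMinor w n i *
        toeplitzMinor (fun m => w (-m)) n j *
          (s * (w ((i : ℤ) - j - 1) - w ((i : ℤ) - j + 1))) := by
        rw [← Finset.sum_sub_distrib, Finset.mul_sum]
        refine Finset.sum_congr rfl fun i _ => ?_
        rw [← Finset.sum_sub_distrib, Finset.mul_sum]
        refine Finset.sum_congr rfl fun j _ => ?_
        rw [sub_right_comm]
        ring
    -- The weights `i` and `j` in `μ + (i - j)` both contribute `n`, so they cancel.
    _ = μ * (toeplitz w n * toeplitz w (n + 1)) + (n : R) * (toeplitz w n * toeplitz w (n + 1)) -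
        (n : R) * (toeplitz w n * toeplitz w (n + 1)) := by
        refine Eq.trans ?_ (congrArg₂ _ (congrArg₂ _ hμ hi) sj)
        rw [← Finset.sum_add_distrib, ← Finset.sum_sub_distrib]
        refine Finset.sum_congr rfl fun i _ => ?_
        rw [← Finset.sum_add_distrib, ← Finset.sum_sub_distrib]
        refine Finset.sum_congr rfl fun j _ => ?_
        rw [hw]
        push_cast
        ring
    _ = _ := by ring

/-- For coefficients satisfying the Bessel recurrence, expanding the constant term of
`z π_n' - n π_n` in two ways gives the bilinear form of discrete Painlevé II. -/
theorem toeplitz_dPII (w : ℤ → R) (s μ : R)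
    (hw : ∀ m : ℤ, s * (w (m - 1) - w (m + 1)) = (μ + m) * w m) (n : ℕ) :
    s * (toeplitz (fun m => w (m + 1)) n * toeplitz w (n + 2) +
        toeplitz (fun m => w (m + 1)) (n + 2) * toeplitz w n) =
      ((n : R) + 1) * (toeplitz w (n + 1) * toeplitz (fun m => w (m + 1)) (n + 1)) := by
  set c := toeplitzMinor w (n + 1) with hc
  set d := toeplitzMinor w n with hd
  -- Pairing `P_{n+1} z^{j-k}` for each `j` first.
  have sumI : ∀ (f : ℕ → R) (k : ℤ), ∑ i : Fin (n + 2), ∑ j : Fin (n + 1),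
        f j * c i * d j * w ((i : ℤ) + j - k) =
      ∑ j : Fin (n + 1), f j * d j * minorPairing w (n + 1) (k - j) := by
    intro f k
    rw [Finset.sum_comm]
    refine Finset.sum_congr rfl fun j _ => ?_
    rw [minorPairing, Finset.mul_sum]
    refine Finset.sum_congr rfl fun i _ => ?_
    rw [show (i : ℤ) - (k - j) = i + j - k by ring]
    ring
  -- The factor `i - (n + 1)` removes the leading term of `P_{n+1}`; pairing with `P_n z^{-n}` then
  -- picks out the constant term, because `n - i` lies in `[0, n]`.
  have hJ : ∑ i : Fin (n + 2), ∑ j : Fin (n + 1),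
        ((i : ℕ) - (n + 1) : R) * c i * d j * w ((i : ℤ) + j - n) =
      -((n : R) + 1) * c 0 * toeplitz w (n + 1) := by
    have : ∀ i : Fin (n + 2), ∑ j, ((i : ℕ) - (n + 1) : R) * c i * d j * w ((i : ℤ) + j - n) =
        ((i : ℕ) - (n + 1) : R) * c i * minorPairing w n (n - i) := by
      intro i
      rw [minorPairing, Finset.mul_sum]
      refine Finset.sum_congr rfl fun j _ => ?_
      rw [show (j : ℤ) - (n - i) = i + j - n by ring]
      ring
    rw [Finset.sum_congr rfl fun i _ => this i, Fin.sum_univ_castSucc, Fin.sum_univ_succ,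
      Finset.sum_eq_zero fun i _ => ?_]
    · simp [minorPairing_self]
    · rw [minorPairing_eq_zero _ _ _ ?_ ?_, mul_zero]
      · have := i.isLt
        simp
      · simp
  -- `P_{n+1}` is orthogonal to every `z^{j-n}` with `0 ≤ j ≤ n`.
  have hf : ∀ f : ℕ → R, ∑ i : Fin (n + 2), ∑ j : Fin (n + 1),
        f j * c i * d j * w ((i : ℤ) + j - n) = 0 := by
    intro f
    rw [sumI]
    refine Finset.sum_eq_zero fun j _ => ?_
    have := j.isLt
    rw [minorPairing_eq_zero _ _ _ (by omega) (by push_cast; omega), mul_zero]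
  -- After the shift by `z^{-1}` only `j = 0` survives, after the shift by `z` only `j = n`.
  have hm : ∑ i : Fin (n + 2), ∑ j : Fin (n + 1),
        1 * c i * d j * w ((i : ℤ) + j - (n + 1)) = d 0 * toeplitz w (n + 2) := by
    rw [sumI (fun _ => 1), Fin.sum_univ_succ, Finset.sum_eq_zero fun j _ => ?_]
    · have := minorPairing_self w (n + 1)
      push_cast at this
      simp [this]
    · have := j.isLt
      rw [minorPairing_eq_zero _ _ _ (by simp) (by simp), mul_zero]
  have hp : ∑ i : Fin (n + 2), ∑ j : Fin (n + 1),
        1 * c i * d j * w ((i : ℤ) + j - (n - 1)) =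
      d (Fin.last n) * ((-1) ^ (n + 1) * toeplitz (fun m => w (m + 1)) (n + 2)) := by
    rw [sumI (fun _ => 1), Fin.sum_univ_castSucc, Finset.sum_eq_zero fun j _ => ?_]
    · have := minorPairing_neg_one w (n + 1)
      simp [this]
    · have := j.isLt
      rw [minorPairing_eq_zero _ _ _ (by simp) (by simp; omega), mul_zero]
  -- The recurrence at `m = i + j - n`, with `μ + m` split as `(i - (n + 1)) + (j + 1 + μ)`.
  have key : s * (∑ i : Fin (n + 2), ∑ j : Fin (n + 1),
        1 * c i * d j * w ((i : ℤ) + j - (n + 1)) -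
      ∑ i : Fin (n + 2), ∑ j : Fin (n + 1),
        1 * c i * d j * w ((i : ℤ) + j - (n - 1))) =
      ∑ i : Fin (n + 2), ∑ j : Fin (n + 1),
        ((i : ℕ) - (n + 1) : R) * c i * d j * w ((i : ℤ) + j - n) +
        ∑ i : Fin (n + 2), ∑ j : Fin (n + 1),
        (fun j : ℕ => (j + 1 + μ : R)) j * c i * d j * w ((i : ℤ) + j - n) := by
    rw [← Finset.sum_sub_distrib, ← Finset.sum_add_distrib, Finset.mul_sum]
    refine Finset.sum_congr rfl fun i _ => ?_
    rw [← Finset.sum_sub_distrib, ← Finset.sum_add_distrib, Finset.mul_sum]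
    refine Finset.sum_congr rfl fun j _ => ?_
    have := hw ((i : ℤ) + j - n)
    rw [show (i : ℤ) + j - n - 1 = i + j - (n + 1) by ring,
      show (i : ℤ) + j - n + 1 = i + j - (n - 1) by ring] at this
    push_cast at this
    linear_combination (c i * d j) * this
  rw [hJ, hf fun j => (j : R) + 1 + μ, hm, hp] at key
  simp only [hc, hd, toeplitzMinor_zero, toeplitzMinor_last] at key
  have h2 := neg_one_pow_mul_self R n
  rw [pow_succ] at key
  linear_combination (-1) ^ n * key + (((n : R) + 1) * (toeplitz w (n + 1) *
    toeplitz (fun m => w (m + 1)) (n + 1)) - s * (toeplitz (fun m => w (m + 1)) n *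
    toeplitz w (n + 2) + toeplitz (fun m => w (m + 1)) (n + 2) * toeplitz w n)) * h2

end Toeplitz

open Complex Filter Topology

/-! ### Modified Bessel functions -/

/-- The `k`-th coefficient of the entire function `F_ν(y) = (√y)^{-ν} I_ν(2√y)`. -/
noncomputable def besselCoeff (ν : ℂ) (k : ℕ) : ℂ :=
  1 / ((k.factorial : ℂ) * Gamma (ν + k + 1))

/-- The entire function `F_ν(y) = ∑ₖ y^k / (k! Γ(ν+k+1))`, so that
`I_ν(x) = (x/2)^ν F_ν((x/2)²)`. -/
noncomputable def besselEntire (ν y : ℂ) : ℂ := ∑' k : ℕ, besselCoeff ν k * y ^ k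

theorem besselI_eq (ν x : ℂ) : besselI ν x = (x / 2) ^ ν * besselEntire ν ((x / 2) ^ 2) := by
  simp only [besselI, besselEntire, besselCoeff, pow_mul, one_div_mul_eq_div]

theorem inv_Gamma_eq (z : ℂ) : (Gamma z)⁻¹ = z * (Gamma (z + 1))⁻¹ :=
  one_div_Gamma_eq_self_mul_one_div_Gamma_add_one z

theorem besselCoeff_sub_one (ν : ℂ) (k : ℕ) :
    besselCoeff (ν - 1) k = (ν + k) * besselCoeff ν k := by
  simp only [besselCoeff, one_div, mul_inv]
  rw [show ν - 1 + k + 1 = ν + k by ring, inv_Gamma_eq (ν + k)]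
  ring

theorem besselCoeff_succ (ν : ℂ) (k : ℕ) :
    ((k : ℂ) + 1) * besselCoeff ν (k + 1) = besselCoeff (ν + 1) k := by
  have hk : (k : ℂ) + 1 ≠ 0 := by exact_mod_cast k.succ_ne_zero
  simp only [besselCoeff, Nat.factorial_succ]
  push_cast
  rw [show ν + (k + 1) + 1 = ν + 1 + k + 1 by ring]
  field_simp

theorem exists_bound_inv_Gamma (ν : ℂ) : ∃ C, ∀ k : ℕ, ‖(Gamma (ν + k + 1))⁻¹‖ ≤ C := by
  obtain ⟨K, hK⟩ := exists_nat_ge (‖ν‖ + 1)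
  -- Beyond `K` the factor `ν + k + 1` in the functional equation has modulus at least one.
  have hanti : ∀ m : ℕ, ‖(Gamma (ν + (K + m : ℕ) + 1))⁻¹‖ ≤ ‖(Gamma (ν + K + 1))⁻¹‖ := by
    intro m
    induction m with
    | zero => simp
    | succ m ih =>
      refine le_trans ?_ ih
      rw [inv_Gamma_eq (ν + (K + m : ℕ) + 1), norm_mul]
      have h1 : (1 : ℝ) ≤ ‖ν + (K + m : ℕ) + 1‖ := by
        have h := norm_sub_norm_le (((K + m + 1 : ℕ) : ℂ)) (-ν)
        rw [Complex.norm_natCast, norm_neg, sub_neg_eq_add] at h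
        rw [show ν + (K + m : ℕ) + 1 = ((K + m + 1 : ℕ) : ℂ) + ν by push_cast; ring]
        push_cast at h ⊢
        have : (0 : ℝ) ≤ m := m.cast_nonneg
        linarith
      have e : ν + (K + (m + 1) : ℕ) + 1 = ν + (K + m : ℕ) + 1 + 1 := by push_cast; ring
      rw [e]
      exact le_mul_of_one_le_left (norm_nonneg _) h1
  refine ⟨∑ k ∈ Finset.range (K + 1), ‖(Gamma (ν + k + 1))⁻¹‖, fun k => ?_⟩
  rcases lt_or_ge k (K + 1) with h | h
  · exact Finset.single_le_sum (f := fun k : ℕ => ‖(Gamma (ν + k + 1))⁻¹‖)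
      (fun _ _ => norm_nonneg _) (Finset.mem_range.2 h)
  · obtain ⟨m, rfl⟩ := Nat.exists_eq_add_of_le (Nat.le_of_succ_le h)
    exact (hanti m).trans (Finset.single_le_sum (f := fun k : ℕ => ‖(Gamma (ν + k + 1))⁻¹‖)
      (fun _ _ => norm_nonneg _) (Finset.mem_range.2 K.lt_succ_self))

theorem summable_norm_besselCoeff (ν : ℂ) (r : ℝ) :
    Summable fun k : ℕ => ‖besselCoeff ν k‖ * r ^ k := by
  obtain ⟨C, hC⟩ := exists_bound_inv_Gamma ν
  refine Summable.of_norm_bounded ((Real.summable_pow_div_factorial |r|).mul_left C) fun k => ?_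
  rw [norm_mul, norm_norm, norm_pow, Real.norm_eq_abs, besselCoeff, one_div, mul_inv, norm_mul,
    norm_inv, Complex.norm_natCast]
  calc _ = ‖(Gamma (ν + k + 1))⁻¹‖ * (|r| ^ k / k.factorial) := by ring
    _ ≤ _ := by
      gcongr
      exact hC k

theorem summable_besselCoeff (ν y : ℂ) : Summable fun k : ℕ => besselCoeff ν k * y ^ k := by
  refine Summable.of_norm ?_
  simpa only [norm_mul, norm_pow] using summable_norm_besselCoeff ν ‖y‖

theorem hasSum_besselEntire_add_one (ν y : ℂ) :
    HasSum (fun k : ℕ => (k : ℂ) * besselCoeff ν k * y ^ (k - 1)) (besselEntire (ν + 1) y) := by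
  have h : HasSum (fun k : ℕ => ((k + 1 : ℕ) : ℂ) * besselCoeff ν (k + 1) * y ^ k)
      (besselEntire (ν + 1) y) := by
    push_cast
    simp only [besselCoeff_succ]
    exact (summable_besselCoeff (ν + 1) y).hasSum
  have h' := (hasSum_nat_add_iff (f := fun k : ℕ => (k : ℂ) * besselCoeff ν k * y ^ (k - 1)) 1).1 h
  simpa only [Finset.range_one, Finset.sum_singleton, Nat.cast_zero, zero_mul, add_zero] using h'

theorem hasDerivAt_besselEntire (ν y : ℂ) :
    HasDerivAt (besselEntire ν) (besselEntire (ν + 1) y) y := by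
  obtain ⟨r, hr⟩ := exists_gt ‖y‖
  have hu : Summable fun k : ℕ => ‖(k : ℂ) * besselCoeff ν k‖ * r ^ (k - 1) := by
    rw [← summable_nat_add_iff 1]
    refine (summable_norm_besselCoeff (ν + 1) r).congr fun k => ?_
    rw [← besselCoeff_succ, Nat.add_sub_cancel]
    push_cast
    rfl
  have hy : y ∈ Metric.ball (0 : ℂ) r := mem_ball_zero_iff.2 hr
  have hg : ∀ (k : ℕ) (z : ℂ), z ∈ Metric.ball (0 : ℂ) r →
      HasDerivAt (fun z => besselCoeff ν k * z ^ k)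
        ((k : ℂ) * besselCoeff ν k * z ^ (k - 1)) z := by
    intro k z _
    exact ((hasDerivAt_pow k z).const_mul (besselCoeff ν k)).congr_deriv (by ring)
  have hg' : ∀ (k : ℕ) (z : ℂ), z ∈ Metric.ball (0 : ℂ) r →
      ‖(k : ℂ) * besselCoeff ν k * z ^ (k - 1)‖ ≤ ‖(k : ℂ) * besselCoeff ν k‖ * r ^ (k - 1) := by
    intro k z hz
    rw [norm_mul, norm_pow]
    have : ‖z‖ ≤ r := (mem_ball_zero_iff.1 hz).le
    gcongr
  have h := hasDerivAt_tsum_of_isPreconnected hu Metric.isOpen_ball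
    (convex_ball (0 : ℂ) r).isPreconnected hg hg' hy (summable_besselCoeff ν y) hy
  rw [(hasSum_besselEntire_add_one ν y).tsum_eq] at h
  exact h

theorem besselEntire_recurrence (ν y : ℂ) :
    besselEntire (ν - 1) y - y * besselEntire (ν + 1) y = ν * besselEntire ν y := by
  have h1 := (summable_besselCoeff (ν - 1) y).hasSum
  have h2 := (hasSum_besselEntire_add_one ν y).mul_left y
  have h3 := (summable_besselCoeff ν y).hasSum.mul_left ν
  refine (h1.sub h2).unique (h3.congr_fun ?_)
  intro k
  rw [besselCoeff_sub_one]
  rcases k with _ | k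
  · simp
  · simp only [add_tsub_cancel_right]
    ring

theorem besselI_recurrence (ν x : ℂ) (hx : x ≠ 0) :
    x / 2 * (besselI (ν - 1) x - besselI (ν + 1) x) = ν * besselI ν x := by
  have hx2 : x / 2 ≠ 0 := div_ne_zero hx two_ne_zero
  simp only [besselI_eq, cpow_add _ _ hx2, cpow_sub _ _ hx2, cpow_one]
  have := besselEntire_recurrence ν ((x / 2) ^ 2)
  field_simp at this ⊢
  linear_combination (x / 2) ^ ν * this

/-! ### The seed -/

theorem csqrt_ne_zero {t : ℂ} (ht : t ≠ 0) : csqrt t ≠ 0 := by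
  simp [csqrt, cpow_eq_zero_iff, ht]

theorem csqrt_sq (t : ℂ) : csqrt t ^ 2 = t := by
  have := cpow_nat_inv_pow t two_ne_zero
  simpa only [csqrt, one_div, Nat.cast_ofNat] using this

theorem csqrt_four_mul (t : ℂ) : csqrt (4 * t) = 2 * csqrt t := by
  by_cases ht : t = 0
  · simp [csqrt, ht]
  have h4 : (4 : ℂ) = ((4 : ℝ) : ℂ) := by norm_num
  have h2 : csqrt 4 = 2 := by
    have := sq_cpow_two_inv (x := 2) (by norm_num)
    norm_num at this
    simpa [csqrt] using this
  have : csqrt (4 * t) = csqrt 4 * csqrt t := by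
    rw [csqrt, csqrt, csqrt, cpow_def_of_ne_zero (by simp [ht]), cpow_def_of_ne_zero ht,
      cpow_def_of_ne_zero (by norm_num : (4 : ℂ) ≠ 0), ← exp_add, ← add_mul, h4,
      ← ofReal_log (by norm_num), log_ofReal_mul (by norm_num) ht]
  rw [this, h2]

/-- On all of `ℂ \ {0}` the branches of `u^{-μ/2}` and `(√u / 2)^μ` cancel. -/
theorem cpow_mul_besselI_csqrt (μ u : ℂ) (hu : u ≠ 0) :
    u ^ (-μ / 2) * besselI μ (csqrt u) = (2 ^ μ)⁻¹ * besselEntire μ (u / 4) := by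
  have hlog : log (csqrt u / 2) = log u / 2 - log 2 := by
    have h1 : log (csqrt u) = log u / 2 := by
      rw [csqrt, cpow_def_of_ne_zero hu, log_exp]
      · ring
      · have := neg_pi_lt_log_im u
        have hp := Real.pi_pos
        simp
        linarith
      · have := log_im_le_pi u
        have hp := Real.pi_pos
        simp
        linarith
    have h2 : csqrt u / 2 = ((2⁻¹ : ℝ) : ℂ) * csqrt u := by
      push_cast
      ring
    rw [h2, log_ofReal_mul (by norm_num) (csqrt_ne_zero hu), h1, Real.log_inv]
    push_cast [ofReal_log]
    rw [ofReal_log (by norm_num)]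
    push_cast
    ring
  rw [besselI_eq, div_pow, csqrt_sq, cpow_def_of_ne_zero hu,
    cpow_def_of_ne_zero (div_ne_zero (csqrt_ne_zero hu) two_ne_zero),
    cpow_def_of_ne_zero two_ne_zero, hlog, ← mul_assoc, ← exp_add, ← exp_neg,
    show log u * (-μ / 2) + (log u / 2 - log 2) * μ = -(log 2 * μ) by ring,
    show u / 2 ^ 2 = u / 4 by norm_num]

/-- The seed `q₀` as a quotient of Bessel functions. -/
theorem seed_q (μ t : ℂ) (ht : t ≠ 0) :
    (seed μ t).q =
      csqrt t * (besselI (μ + 1) (csqrt (4 * t)) / besselI μ (csqrt (4 * t))) := by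
  have h4 : 4 * t ≠ 0 := by simp [ht]
  have hc := csqrt_ne_zero ht
  have hev : (fun u : ℂ => u ^ (-μ / 2) * besselI μ (csqrt u)) =ᶠ[𝓝 (4 * t)]
      fun u => (2 ^ μ)⁻¹ * besselEntire μ (u / 4) := by
    filter_upwards [isOpen_ne.mem_nhds h4] with u hu using cpow_mul_besselI_csqrt μ u hu
  have hd : HasDerivAt (fun u => ((2 : ℂ) ^ μ)⁻¹ * besselEntire μ (u / 4))
      ((2 ^ μ)⁻¹ * (besselEntire (μ + 1) (4 * t / 4) * (1 / 4))) (4 * t) :=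
    ((hasDerivAt_besselEntire μ (4 * t / 4)).comp (4 * t)
      ((hasDerivAt_id (4 * t)).div_const 4)).const_mul _
  have h2 : ((2 : ℂ) ^ μ)⁻¹ ≠ 0 := by simp [cpow_eq_zero_iff]
  have h3 : csqrt t ^ μ ≠ 0 := by simp [cpow_eq_zero_iff, hc]
  have e : 4 * t / 4 = t := by ring
  simp only [seed, logDeriv_apply]
  rw [hev.deriv_eq, hev.eq_of_nhds, hd.deriv, mul_div_mul_left _ _ h2, besselI_eq, besselI_eq,
    csqrt_four_mul, mul_div_cancel_left₀ _ (two_ne_zero' ℂ), csqrt_sq, cpow_add _ _ hc, cpow_one,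
    e, mul_assoc (csqrt t ^ μ), mul_div_mul_left _ _ h3]
  have := csqrt_sq t
  linear_combination (-besselEntire (μ + 1) t / besselEntire μ t) * this

/-! ### The Toeplitz determinants of Bessel functions -/

section Bessel

variable (μ t : ℂ)

/-- The symbol coefficients `I_{μ+m}(√(4t))`. -/
noncomputable def besselSymbol (m : ℤ) : ℂ := besselI (μ + m) (csqrt (4 * t))

theorem besselSymbol_recurrence (ht : t ≠ 0) (m : ℤ) :
    csqrt t * (besselSymbol μ t (m - 1) - besselSymbol μ t (m + 1)) =
      (μ + m) * besselSymbol μ t m := by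
  have := besselI_recurrence (μ + m) (csqrt (4 * t)) (csqrt_ne_zero (by simp [ht]))
  rw [csqrt_four_mul, mul_div_cancel_left₀ _ (two_ne_zero' ℂ), ← csqrt_four_mul] at this
  simp only [besselSymbol]
  push_cast
  rw [← add_sub_assoc, ← add_assoc]
  exact this

theorem toeplitzDet_eq (ε : ℤ) (N : ℕ) :
    toeplitzDet μ ε N (4 * t) = toeplitz (fun m => besselSymbol μ t (m + ε)) N := by
  rw [toeplitzDet, toeplitz]
  congr 1
  ext j k
  simp only [Matrix.of_apply, besselSymbol]
  push_cast
  congr 1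
  ring

theorem toeplitzDet_zero_right (ε : ℤ) (u : ℂ) : toeplitzDet μ ε 0 u = 1 := by
  simp [toeplitzDet]

theorem toeplitzDet_skew (ht : t ≠ 0) (n : ℕ) :
    csqrt t * (toeplitzDet μ 1 n (4 * t) * toeplitzDet μ (-1) (n + 1) (4 * t) -
        toeplitzDet μ (-1) n (4 * t) * toeplitzDet μ 1 (n + 1) (4 * t)) =
      μ * (toeplitzDet μ 0 n (4 * t) * toeplitzDet μ 0 (n + 1) (4 * t)) := by
  have := toeplitz_skew (besselSymbol μ t) _ μ (besselSymbol_recurrence μ t ht) n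
  simpa only [toeplitzDet_eq, add_zero, ← sub_eq_add_neg] using this

theorem toeplitzDet_dPII (ht : t ≠ 0) (n : ℕ) :
    csqrt t * (toeplitzDet μ 1 n (4 * t) * toeplitzDet μ 0 (n + 2) (4 * t) +
        toeplitzDet μ 1 (n + 2) (4 * t) * toeplitzDet μ 0 n (4 * t)) =
      ((n : ℂ) + 1) * (toeplitzDet μ 0 (n + 1) (4 * t) * toeplitzDet μ 1 (n + 1) (4 * t)) := by
  have := toeplitz_dPII (besselSymbol μ t) _ μ (besselSymbol_recurrence μ t ht) n
  simpa only [toeplitzDet_eq, add_zero] using this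

theorem toeplitzDet_jacobi (n : ℕ) :
    toeplitzDet μ 0 (n + 1) (4 * t) ^ 2 -
        toeplitzDet μ 1 (n + 1) (4 * t) * toeplitzDet μ (-1) (n + 1) (4 * t) =
      toeplitzDet μ 0 n (4 * t) * toeplitzDet μ 0 (n + 2) (4 * t) := by
  have := toeplitz_jacobi (besselSymbol μ t) n
  simpa only [toeplitzDet_eq, add_zero, ← sub_eq_add_neg] using this

theorem reflCoeff_ne_zero {n : ℕ} {u : ℂ} (h0 : toeplitzDet μ 0 n u ≠ 0)
    (h1 : toeplitzDet μ 1 n u ≠ 0) : reflCoeff μ n u ≠ 0 :=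
  mul_ne_zero (pow_ne_zero _ (by norm_num)) (div_ne_zero h1 h0)

theorem one_sub_reflCoeff_mul (n : ℕ) (h : toeplitzDet μ 0 (n + 1) (4 * t) ≠ 0) :
    1 - reflCoeff μ (n + 1) (4 * t) * reflCoeffBar μ (n + 1) (4 * t) =
      toeplitzDet μ 0 n (4 * t) * toeplitzDet μ 0 (n + 2) (4 * t) /
        toeplitzDet μ 0 (n + 1) (4 * t) ^ 2 := by
  rw [eq_div_iff (pow_ne_zero 2 h), ← toeplitzDet_jacobi, reflCoeff, reflCoeffBar]
  have := neg_one_pow_mul_self ℂ (n + 1)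
  field_simp
  linear_combination (-toeplitzDet μ 1 (n + 1) (4 * t) *
    toeplitzDet μ (-1) (n + 1) (4 * t)) * this

theorem reflCoeff_skew (ht : t ≠ 0) (n : ℕ) (h0 : toeplitzDet μ 0 n (4 * t) ≠ 0)
    (h1 : toeplitzDet μ 0 (n + 1) (4 * t) ≠ 0) :
    csqrt t * (reflCoeffBar μ (n + 1) (4 * t) * reflCoeff μ n (4 * t) -
      reflCoeff μ (n + 1) (4 * t) * reflCoeffBar μ n (4 * t)) + μ = 0 := by
  have h := toeplitzDet_skew μ t ht n
  have h2 := neg_one_pow_mul_self ℂ n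
  simp only [reflCoeff, reflCoeffBar, pow_succ]
  field_simp
  linear_combination (-1) * h - (csqrt t * (toeplitzDet μ 1 n (4 * t) *
    toeplitzDet μ (-1) (n + 1) (4 * t) - toeplitzDet μ (-1) n (4 * t) *
    toeplitzDet μ 1 (n + 1) (4 * t))) * h2

theorem reflCoeff_dPII (ht : t ≠ 0) (n : ℕ) (h0 : toeplitzDet μ 0 n (4 * t) ≠ 0)
    (h1 : toeplitzDet μ 0 (n + 1) (4 * t) ≠ 0) (h2 : toeplitzDet μ 0 (n + 2) (4 * t) ≠ 0) :
    csqrt t * (1 - reflCoeff μ (n + 1) (4 * t) * reflCoeffBar μ (n + 1) (4 * t)) *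
      (reflCoeff μ (n + 2) (4 * t) + reflCoeff μ n (4 * t)) +
      ((n : ℂ) + 1) * reflCoeff μ (n + 1) (4 * t) = 0 := by
  have h := toeplitzDet_dPII μ t ht n
  rw [one_sub_reflCoeff_mul μ t n h1]
  simp only [reflCoeff, pow_succ]
  field_simp
  linear_combination (-1) ^ n * h

end Bessel

/-! ### Equivalence of the recurrences at a single index -/

section Algebra

variable {K : Type*} [Field K] {s μ r r' rb rb' : K}

theorem recP_of_skew (hs : s ≠ 0) (hr : r ≠ 0) (h : s * (rb' * r - r' * rb) + μ = 0) :
    1 - r' * rb' = (-s * (r' / r)) ^ 2 / s ^ 2 * (1 - r * rb - 1) -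
      μ * (-s * (r' / r) / s ^ 2) + 1 := by
  field_simp
  linear_combination (-r' * r) * h

theorem recP_iff_skew (hs : s ≠ 0) (hr : r ≠ 0) (hr' : r' ≠ 0) :
    1 - r' * rb' = (-s * (r' / r)) ^ 2 / s ^ 2 * (1 - r * rb - 1) -
      μ * (-s * (r' / r) / s ^ 2) + 1 ↔ s * (rb' * r - r' * rb) + μ = 0 := by
  refine ⟨fun h => ?_, recP_of_skew hs hr⟩
  field_simp at h
  refine mul_left_cancel₀ (mul_ne_zero hr' hr) ?_
  linear_combination -h

/-- By the recurrence for `p`, the denominator in the recurrence for `q` is `s² p'`. -/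
theorem recQ_iff_dPII {r'' n : K} (hs : s ≠ 0) (hr : r ≠ 0) (hr' : r' ≠ 0)
    (hp : 1 - r' * rb' ≠ 0) (h : s * (rb' * r - r' * rb) + μ = 0) :
    -s * (r'' / r') = -(s ^ 2 / (-s * (r' / r))) +
      n * s ^ 2 / (-s * (r' / r) * (-s * (r' / r) * (1 - r * rb - 1) - μ) + s ^ 2) ↔
    s * (1 - r' * rb') * (r'' + r) + n * r' = 0 := by
  have hd : -s * (r' / r) * (-s * (r' / r) * (1 - r * rb - 1) - μ) + s ^ 2 =
      s ^ 2 * (1 - r' * rb') := by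
    rw [recP_of_skew hs hr h]
    field_simp
    ring
  rw [hd]
  constructor
  · intro h
    field_simp at h
    linear_combination -h
  · intro h
    field_simp
    linear_combination -h

/-- Two consecutive skew relations turn one discrete Painlevé II equation into the other. -/
theorem skew_iff_dPII_bar {r'' rb'' n : K} (hr' : r' ≠ 0)
    (hp : 1 - r' * rb' ≠ 0) (h : s * (rb' * r - r' * rb) + μ = 0)
    (hd : s * (1 - r' * rb') * (r'' + r) + n * r' = 0) :
    s * (rb'' * r' - r'' * rb') + μ = 0 ↔ s * (1 - r' * rb') * (rb'' + rb) + n * rb' = 0 := by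
  constructor
  · intro h'
    refine mul_left_cancel₀ hr' ?_
    linear_combination (1 - r' * rb') * (h' - h) + rb' * hd
  · intro h'
    refine mul_left_cancel₀ hp ?_
    linear_combination r' * h' - rb' * hd + (1 - r' * rb') * h

theorem coupled_fst_iff_dPII {r'' n : K} (hrb' : rb' ≠ 0) (hp : 1 - r' * rb' ≠ 0)
    (h : s * (rb' * r - r' * rb) + μ = 0) :
    s * (r'' * rb' + r' * rb) + n * (r' * rb' / (1 - r' * rb')) - μ = 0 ↔
      s * (1 - r' * rb') * (r'' + r) + n * r' = 0 := by
  have e : (s * (r'' * rb' + r' * rb) + n * (r' * rb' / (1 - r' * rb')) - μ) * (1 - r' * rb') =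
      rb' * (s * (1 - r' * rb') * (r'' + r) + n * r') := by
    linear_combination (-(1 - r' * rb')) * h + n * div_mul_cancel₀ (r' * rb') hp
  rw [← mul_eq_zero_iff_right hp, e, mul_eq_zero_iff_left hrb']

theorem coupled_snd_iff_dPII {rb'' n : K} (hr' : r' ≠ 0) (hp : 1 - r' * rb' ≠ 0)
    (h : s * (rb' * r - r' * rb) + μ = 0) :
    s * (rb'' * r' + rb' * r) + n * (r' * rb' / (1 - r' * rb')) + μ = 0 ↔
      s * (1 - r' * rb') * (rb'' + rb) + n * rb' = 0 := by
  have e : (s * (rb'' * r' + rb' * r) + n * (r' * rb' / (1 - r' * rb')) + μ) * (1 - r' * rb') =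
      r' * (s * (1 - r' * rb') * (rb'' + rb) + n * rb') := by
    linear_combination (1 - r' * rb') * h + n * div_mul_cancel₀ (r' * rb') hp
  rw [← mul_eq_zero_iff_right hp, e, mul_eq_zero_iff_left hr']

end Algebra

/-! ### The Hamiltonian variables in terms of the reflection coefficients -/

theorem ham_eq_reflCoeff (μ t : ℂ) (ht : t ≠ 0) (N : ℕ)
    (h0 : ∀ n ≤ N + 1, toeplitzDet μ 0 n (4 * t) ≠ 0)
    (h1 : ∀ n ≤ N, toeplitzDet μ 1 n (4 * t) ≠ 0) :
    hamP μ N t = 1 - reflCoeff μ N (4 * t) * reflCoeffBar μ N (4 * t) ∧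
    hamQ μ N t = -csqrt t * (reflCoeff μ (N + 1) (4 * t) / reflCoeff μ N (4 * t)) := by
  have hs := csqrt_ne_zero ht
  induction N with
  | zero =>
    refine ⟨by simp [hamP, seed, reflCoeff, reflCoeffBar, toeplitzDet_zero_right], ?_⟩
    rw [hamQ, Function.iterate_zero_apply, seed_q μ t ht]
    simp [reflCoeff, toeplitzDet]
  | succ n ih =>
    obtain ⟨hp, hq⟩ := ih (fun m hm => h0 m (by omega)) fun m hm => h1 m (by omega)
    have hr := reflCoeff_ne_zero μ (h0 n (by omega)) (h1 n (by omega))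
    have hr' := reflCoeff_ne_zero μ (h0 (n + 1) (by omega)) (h1 (n + 1) (by omega))
    have hsk := reflCoeff_skew μ t ht n (h0 n (by omega)) (h0 (n + 1) (by omega))
    have hP := (hamRec_ham μ t).1 n
    have hQ := (hamRec_ham μ t).2 n
    simp only [hp, hq] at hP hQ
    refine ⟨?_, ?_⟩
    · rw [hP, recP_of_skew hs hr hsk, csqrt_sq]
    · have hne : 1 - reflCoeff μ (n + 1) (4 * t) * reflCoeffBar μ (n + 1) (4 * t) ≠ 0 := by
        rw [one_sub_reflCoeff_mul μ t n (h0 _ (by omega))]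
        exact div_ne_zero (mul_ne_zero (h0 _ (by omega)) (h0 _ (by omega)))
          (pow_ne_zero _ (h0 _ (by omega)))
      have := (recQ_iff_dPII hs hr hr' hne hsk).2
        (reflCoeff_dPII μ t ht n (h0 _ (by omega)) (h0 _ (by omega)) (h0 _ (by omega)))
      rw [hQ, this, csqrt_sq]

/-! ### Equivalence of the recurrence schemes -/

section Schemes

variable {μ t : ℂ} {r rb p q : ℕ → ℂ}

theorem half_mul_csqrt (t : ℂ) : 1 / 2 * csqrt (4 * t) = csqrt t := by
  rw [csqrt_four_mul]
  ring

theorem hamRecP_iff (ht : t ≠ 0) (hr : ∀ N, r N ≠ 0) (hp : ∀ N, p N = 1 - r N * rb N)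
    (hq : ∀ N, q N = -csqrt t * (r (N + 1) / r N)) :
    HamRecP μ t p q ↔ ∀ N, SkewRelationAt μ (4 * t) r rb N := by
  refine forall_congr' fun N => ?_
  rw [SkewRelationAt, half_mul_csqrt, hp, hp, hq,
    ← recP_iff_skew (csqrt_ne_zero ht) (hr N) (hr (N + 1)), csqrt_sq]

theorem hamRecQ_iff (ht : t ≠ 0) (hr : ∀ N, r N ≠ 0) (hne : ∀ N, 1 ≤ N → 1 - r N * rb N ≠ 0)
    (hp : ∀ N, p N = 1 - r N * rb N) (hq : ∀ N, q N = -csqrt t * (r (N + 1) / r N))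
    (hsk : ∀ N, SkewRelationAt μ (4 * t) r rb N) :
    HamRecQ μ t p q ↔ DPIIFirst (4 * t) r rb := by
  have key : ∀ N : ℕ, q (N + 1) = -(t / q N) +
      ((N : ℂ) + 1) * t / (q N * (q N * (p N - 1) - μ) + t) ↔
      csqrt t * (1 - r (N + 1) * rb (N + 1)) * (r (N + 2) + r N) +
        ((N : ℂ) + 1) * r (N + 1) = 0 := by
    intro N
    have h := hsk N
    rw [SkewRelationAt, half_mul_csqrt] at h
    rw [hp, hq, hq, ← recQ_iff_dPII (csqrt_ne_zero ht) (hr N) (hr (N + 1)) (hne _ (by omega)) h,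
      csqrt_sq]
  constructor
  · rintro h (_ | N) hN
    · omega
    · rw [half_mul_csqrt]
      simpa using (key N).1 (h N)
  · intro h N
    have := h (N + 1) (by omega)
    rw [half_mul_csqrt] at this
    exact (key N).2 (by simpa using this)

/-- Under the first discrete Painlevé II equation, the second one at `N + 1` propagates the skew
relation from `N` to `N + 1`, and conversely. -/
theorem skew_and_dPII_iff (hr : ∀ N, r N ≠ 0)
    (hne : ∀ N, 1 ≤ N → 1 - r N * rb N ≠ 0) :
    (∀ N, SkewRelationAt μ (4 * t) r rb N) ∧ DPIIFirst (4 * t) r rb ↔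
      SkewRelationAt μ (4 * t) r rb 0 ∧ DPIIFirst (4 * t) r rb ∧ DPIISecond (4 * t) r rb := by
  have key : DPIIFirst (4 * t) r rb → ∀ N, SkewRelationAt μ (4 * t) r rb N →
      (SkewRelationAt μ (4 * t) r rb (N + 1) ↔
        (1 / 2) * csqrt (4 * t) * (1 - r (N + 1) * rb (N + 1)) * (rb (N + 1 + 1) + rb (N + 1 - 1)) +
          ((N + 1 : ℕ) : ℂ) * rb (N + 1) = 0) := by
    intro hd N h
    have hd' := hd (N + 1) (by omega)
    rw [SkewRelationAt, half_mul_csqrt] at *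
    exact skew_iff_dPII_bar (hr _) (hne _ (by omega)) h hd'
  constructor
  · rintro ⟨hsk, hd⟩
    refine ⟨hsk 0, hd, ?_⟩
    rintro (_ | N) hN
    · omega
    · exact (key hd N (hsk N)).1 (hsk (N + 1))
  · rintro ⟨h0, hd, hdb⟩
    refine ⟨fun N => ?_, hd⟩
    induction N with
    | zero => exact h0
    | succ N ih => exact (key hd N ih).2 (hdb (N + 1) (by omega))

theorem skew_and_dPII_iff_coupled (hr : ∀ N, r N ≠ 0) (hrb : ∀ N, rb N ≠ 0)
    (hne : ∀ N, 1 ≤ N → 1 - r N * rb N ≠ 0) :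
    (∀ N, SkewRelationAt μ (4 * t) r rb N) ∧ DPIIFirst (4 * t) r rb ↔
      SkewRelationAt μ (4 * t) r rb 0 ∧ OPUCRec μ (4 * t) r rb := by
  have key : ∀ N, SkewRelationAt μ (4 * t) r rb N → ∀ M, M = N + 1 →
      (((1 / 2) * csqrt (4 * t) * (r (M + 1) * rb M + r M * rb (M - 1)) +
        (M : ℂ) * (r M * rb M / (1 - r M * rb M)) - μ = 0 ∧
      (1 / 2) * csqrt (4 * t) * (rb (M + 1) * r M + rb M * r (M - 1)) +
        (M : ℂ) * (r M * rb M / (1 - r M * rb M)) + μ = 0) ↔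
      ((1 / 2) * csqrt (4 * t) * (1 - r M * rb M) * (r (M + 1) + r (M - 1)) + (M : ℂ) * r M = 0 ∧
      (1 / 2) * csqrt (4 * t) * (1 - r M * rb M) * (rb (M + 1) + rb (M - 1)) +
        (M : ℂ) * rb M = 0)) := by
    rintro N h M rfl
    rw [SkewRelationAt, half_mul_csqrt] at *
    exact and_congr (coupled_fst_iff_dPII (hrb _) (hne _ (by omega)) h)
      (coupled_snd_iff_dPII (hr _) (hne _ (by omega)) h)
  constructor
  · intro h
    obtain ⟨h0, hd, hdb⟩ := (skew_and_dPII_iff hr hne).1 h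
    refine ⟨h0, ?_⟩
    rintro (_ | N) hN
    · omega
    · exact (key N (h.1 N) _ rfl).2 ⟨hd _ hN, hdb _ hN⟩
  · rintro ⟨h0, he⟩
    -- The two coupled relations at `N + 1` differ by the sum of the skew relations at `N`, `N + 1`.
    have hsk : ∀ N, SkewRelationAt μ (4 * t) r rb N := by
      intro N
      induction N with
      | zero => exact h0
      | succ N ih =>
        obtain ⟨e1, e2⟩ := he (N + 1) (by omega)
        simp only [SkewRelationAt, Nat.add_sub_cancel] at *
        linear_combination e2 - e1 - ih
    refine ⟨hsk, ?_⟩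
    rintro (_ | N) hN
    · omega
    · exact ((key N (hsk N) _ rfl).1 (he _ hN)).1

end Schemes

end PainleveIII

/-! ### The Hamiltonian variables and the recurrence schemes -/

theorem mainTheorem3 (μ t : ℂ) (ht : t ∈ Complex.slitPlane) :
    -- The Hamiltonian variables in terms of the reflection coefficients.
    (∀ N : ℕ, (∀ n ≤ N, toeplitzDet μ 0 n (4 * t) ≠ 0) →
        (∀ n < N, toeplitzDet μ 1 n (4 * t) ≠ 0) →
      hamP μ N t = 1 - reflCoeff μ N (4 * t) * reflCoeffBar μ N (4 * t)) ∧
    (∀ N : ℕ, (∀ n ≤ N + 1, toeplitzDet μ 0 n (4 * t) ≠ 0) →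
        (∀ n ≤ N, toeplitzDet μ 1 n (4 * t) ≠ 0) →
      hamQ μ N t = -csqrt t * (reflCoeff μ (N + 1) (4 * t) / reflCoeff μ N (4 * t))) ∧
    -- Equivalence of the recurrence schemes under this change of variables.
    (∀ r rb p q : ℕ → ℂ, r 0 = 1 → rb 0 = 1 → (∀ N, r N ≠ 0) →
        (∀ N, 1 ≤ N → 1 - r N * rb N ≠ 0) →
        (∀ N, p N = 1 - r N * rb N) → (∀ N, q N = -csqrt t * (r (N + 1) / r N)) →
      (HamRecP μ t p q ↔ ∀ N, SkewRelationAt μ (4 * t) r rb N) ∧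
      (HamRecP μ t p q ∧ HamRecQ μ t p q ↔
        (∀ N, SkewRelationAt μ (4 * t) r rb N) ∧ DPIIFirst (4 * t) r rb) ∧
      (HamRecP μ t p q ∧ HamRecQ μ t p q ↔
        SkewRelationAt μ (4 * t) r rb 0 ∧ DPIIFirst (4 * t) r rb ∧ DPIISecond (4 * t) r rb) ∧
      ((∀ N, rb N ≠ 0) →
        (HamRecP μ t p q ∧ HamRecQ μ t p q ↔
          SkewRelationAt μ (4 * t) r rb 0 ∧ OPUCRec μ (4 * t) r rb))) := by
  have ht0 : t ≠ 0 := Complex.slitPlane_ne_zero ht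
  refine ⟨fun N h0 h1 => ?_, fun N h0 h1 => (ham_eq_reflCoeff μ t ht0 N h0 h1).2, ?_⟩
  · rcases N with _ | N
    · simp [hamP, seed, reflCoeff, reflCoeffBar, toeplitzDet]
    · -- `p_{N+1}` only involves `p_N` and `q_N`, so no condition on the determinants at `N + 2`
      -- or on `I¹_{N+1}` is needed.
      have h1' : ∀ n ≤ N, toeplitzDet μ 1 n (4 * t) ≠ 0 := fun n hn => h1 n (by omega)
      obtain ⟨hp, hq⟩ := ham_eq_reflCoeff μ t ht0 N h0 h1'
      have hP := (hamRec_ham μ t).1 N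
      simp only [hp, hq] at hP
      rw [hP, recP_of_skew (csqrt_ne_zero ht0)
        (reflCoeff_ne_zero μ (h0 N (by omega)) (h1' N le_rfl))
        (reflCoeff_skew μ t ht0 N (h0 N (by omega)) (h0 (N + 1) le_rfl)), csqrt_sq]
  · intro r rb p q _ _ hr hne hp hq
    have hP : HamRecP μ t p q ↔ _ := hamRecP_iff ht0 hr hp hq
    have hPQ : HamRecP μ t p q ∧ HamRecQ μ t p q ↔
        (∀ N, SkewRelationAt μ (4 * t) r rb N) ∧ DPIIFirst (4 * t) r rb := by
      rw [hP]
      exact and_congr_right fun hsk => hamRecQ_iff ht0 hr hne hp hq hsk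
    exact ⟨hP, hPQ, hPQ.trans (skew_and_dPII_iff hr hne),
      fun hrb => hPQ.trans (skew_and_dPII_iff_coupled hr hrb hne)⟩
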